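/- Let $n\ge 1$ and $0\le k\le n$, let $X$ be the set of $k$-subsets of $\{1,\dots,n\}$ (the vertices of the Johnson graph $J(n,k)$), and let $\mathcal F$ be the space of functions $X\to\mathbb C$ with the inner product for which the delta functions $\delta(x)$, $x\in X$, are orthonormal. The symmetric group $S_n$ acts on $\mathcal F$ by $\sigma f=f\circ\sigma^{-1}$; for $1\le j\le n$ let $S_j\subseteq S_n$ be the subgroup of the permutations that fix $j+1,\dots,n$. For $0\le i\le n$ consider the subspaces $$\mathcal F_{1,\lambda_1}\cap\dots\cap\mathcal F_{i,\lambda_i}\cap\mathcal F^{w},$$ where $\mathcal F_{j,\lambda_j}$ is an isotypic component of $\mathcal F$ as a representation of $S_j$, and, for a set $w\subseteq\{i+1,\dots,n\}$, $\mathcal F^w$ is the span of the $\delta(x)$ with $x\cap\{i+1,\dots,n\}=w$. Let $B_0$ be the basis of delta functions, put $B_1=B_0$, and for $1\le i\le n$ let $B_i$ be an orthonormal basis of $\mathcal F$, indexed by $X$, each of whose vectors lies in one of these subspaces (for the index $i$); thus $B_n$ is a Gelfand–Tsetlin basis of $\mathcal F$, and $B_1,\dots,B_{n-1}$ are the intermediate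 bases. Write $[b]_{b'}$ for the matrix whose columns are the coordinate vectors in $b'$ of the vectors of $b$, and $[f]_b$ for the coordinate vector of $f$ in $b$. Then: 1. Each of the above subspaces has dimension at most one (so that $B_i$ is determined up to order and scalars of modulus one), and such bases $B_0,\dots,B_n$ exist; they can be chosen so that all the matrices $[B_i]_{B_{i+1}}$, $1\le i<n$, are real orthogonal matrices. 2. For every choice of such bases, $$[B_0]_{B_n}=[B_{n-1}]_{B_n}\,[B_{n-2}]_{B_{n-1}}\cdots[B_1]_{B_2},$$ and each of the $n-1$ factors is unitary and has at most two nonzero entries in each column. 3. For every choice of such bases there is a straight-line computation, independent of $f$, that computes $[f]_{B_n}=[B_0]_{B_n}[f]_{B_0}$ from $[f]_{B_0}$ for every $f\in\mathcal F$ and that uses at most $2(n-1)\binom nk$ operations. Here one operation is one complex multiplication and addition $c\,u+v$, where $u,v$ are $0$, entries of the input, or results of earlier operations, and $c$ is an entry of one of the factors $[B_i]_{B_{i+1}}$, $1\le i<n$. -/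

import Mathlib

namespace JohnsonFFT

/-- The vertex set of the Johnson graph `J(n,k)`: the `k`-subsets of an `n`-set. A `k`-subset is
also read as a word of length `n` in the letters `1, 2`, with the letter `1` exactly at the places
that belong to the subset. -/
abbrev KSet (n k : ℕ) : Type := Set.powersetCard (Fin n) k

/-- The space of complex functions on the `k`-subsets, with the inner product for which the
delta functions are orthonormal. -/
abbrev FunSpace (n k : ℕ) : Type := EuclideanSpace ℂ (KSet n k)

/-- The basis of delta functions. -/
noncomputable def deltaBasis (n k : ℕ) : OrthonormalBasis (KSet n k) ℂ (FunSpace n k) :=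
  EuclideanSpace.basisFun (KSet n k) ℂ

/-- The action `σ f = f ∘ σ⁻¹` of the symmetric group. -/
noncomputable def permRep (n k : ℕ) :
    Representation ℂ (Equiv.Perm (Fin n)) (FunSpace n k) where
  toFun σ :=
    { toFun := fun f => WithLp.toLp 2 fun x => f (σ⁻¹ • x)
      map_add' := fun _ _ => rfl
      map_smul' := fun _ _ => rfl }
  map_one' := by
    ext f x
    simp
  map_mul' σ τ := by
    ext f x
    change f ((σ * τ)⁻¹ • x) = f (τ⁻¹ • σ⁻¹ • x)
    rw [mul_inv_rev, mul_smul]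

/-- The subgroup `S_j` of the permutations that fix all but the first `j` places. -/
def symSub (n j : ℕ) : Subgroup (Equiv.Perm (Fin n)) :=
  fixingSubgroup (Equiv.Perm (Fin n)) {m : Fin n | j ≤ (m : ℕ)}

/-- The function space as a representation of `S_j`. -/
noncomputable def subRep (n k j : ℕ) : Representation ℂ (symSub n j) (FunSpace n k) :=
  (permRep n k).comp (symSub n j).subtype

/-- The set of the (nonzero) isotypic components of the function space under `S_j`, as complex
subspaces. -/
def isotypicSpaces (n k j : ℕ) : Set (Submodule ℂ (FunSpace n k)) :=
  (fun C : Submodule (MonoidAlgebra ℂ (symSub n j)) (subRep n k j).asModule =>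
      (C.restrictScalars ℂ).map (subRep n k j).asModuleEquiv.toLinearMap) ''
    isotypicComponents (MonoidAlgebra ℂ (symSub n j)) (subRep n k j).asModule

/-- The subspace spanned by the delta functions of the words that agree with the word `w` at all
places after the first `i`. -/
noncomputable def suffixSpace (n k i : ℕ) (w : Finset (Fin n)) : Submodule ℂ (FunSpace n k) :=
  Submodule.span ℂ
    (deltaBasis n k '' {x | ∀ m : Fin n, i ≤ (m : ℕ) → (m ∈ (x : Finset (Fin n)) ↔ m ∈ w)})

/-- The intersection of `C 1, …, C i` with the subspace of the words ending like `w`; here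
`C j` will be an isotypic component under `S_j`. -/
noncomputable def gtSpace (n k i : ℕ) (C : ℕ → Submodule ℂ (FunSpace n k))
    (w : Finset (Fin n)) : Submodule ℂ (FunSpace n k) :=
  (⨅ j ∈ Finset.Icc 1 i, C j) ⊓ suffixSpace n k i w

/-- `b` is an `i`-th intermediate basis: every vector of the orthonormal basis `b` lies in one of
the subspaces `gtSpace` that are given by a choice of an isotypic component under each of
`S_1, …, S_i` and of the letters after place `i`. For `i = n` there is no condition on
letters, and `b` is a Gelfand–Tsetlin basis. -/
def IsGTBasis (n k i : ℕ) (b : OrthonormalBasis (KSet n k) ℂ (FunSpace n k)) : Prop :=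
  ∀ x : KSet n k, ∃ C : ℕ → Submodule ℂ (FunSpace n k), ∃ w : Finset (Fin n),
    (∀ j ∈ Finset.Icc 1 i, C j ∈ isotypicSpaces n k j) ∧ b x ∈ gtSpace n k i C w

/-- A sequence of bases `B 0, …, B n` from the delta basis to a Gelfand–Tsetlin basis through
intermediate bases. (`S_1` is trivial, so the vectors of `B 1` are delta functions up to order and
scalars; they are taken to be the delta functions themselves.) -/
structure IsBasisChain (n k : ℕ)
    (B : ℕ → OrthonormalBasis (KSet n k) ℂ (FunSpace n k)) : Prop where
  zero : B 0 = deltaBasis n k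
  one : B 1 = B 0
  gt : ∀ i, 1 ≤ i → i ≤ n → IsGTBasis n k i (B i)

/-- The change of basis matrix `[b]_{b'}`: its columns are the coordinate vectors in `b'` of
the vectors of `b`. -/
noncomputable def changeMatrix {n k : ℕ} (b b' : OrthonormalBasis (KSet n k) ℂ (FunSpace n k)) :
    Matrix (KSet n k) (KSet n k) ℂ :=
  b'.toBasis.toMatrix b

/-- Straight-line computations on an input vector `a : ι → ℂ`. `Computation A m S` says that `S` is
the set of the quantities, as functions of the input, that are available after `m` operations.
At the start these are the entries of the input and `0`. One operation is one complex
multiplication and addition: it forms `c * u + v` from available `u`, `v` and a constant `c ∈ A`. -/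
inductive Computation {ι : Type} (A : Set ℂ) : ℕ → Set ((ι → ℂ) → ℂ) → Prop
  | start : Computation A 0 (insert (fun _ => 0) (Set.range fun (x : ι) (a : ι → ℂ) => a x))
  | mulAdd {m : ℕ} {S : Set ((ι → ℂ) → ℂ)} {c : ℂ} {u v : (ι → ℂ) → ℂ} :
      Computation A m S → c ∈ A → u ∈ S → v ∈ S →
        Computation A (m + 1) (insert (fun a => c * u a + v a) S)

end JohnsonFFT

/-!
The sum `T_j` of the transpositions of `S_j` is central in the group algebra, so it acts by a scalar
on each isotypic component. The `T_j` with `j ≤ i` and the indicators of the letters after place `i`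
are commuting real symmetric operators, and their joint eigenspaces are at most one-dimensional. To
see this, induct on `i`. If a joint eigenspace had dimension two, restricting the letter at place
`p = i` would produce nonzero joint eigenvectors `f`, `g` with the same eigenvalues, `f` supported
on words with the letter `1` at `p` and `g` on words with the letter `2`. On `f` and `g` the
Jucys–Murphy element `T_(i+1) - T_i` counts the earlier places that carry the same letter as `p`;
equality of the two counts forces the words of `g` above the middle layer of the Boolean lattice of
the first `i` places. There the down operator `D` is injective: with `U` its adjoint, the relation
`D U - U D = i - 2 * size` gives `‖D g‖² = ‖U g‖² + ∑ x, (2 * size x - i) * |g x|²`, where `size x`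
is the number of letters `1` at the first `i` places. But `D g = 0`, since the values of `D g` are
those of the Jucys–Murphy image of `g` at words with the letter `1` at `p`, where `g` vanishes.

Hence `B_i` is a joint eigenbasis. Vectors of `B_i` and `B_(i+1)` that are not orthogonal share the
eigenvalues of `T_1, …, T_i` and the letters after place `i + 1`; the vectors with these data span a
space of dimension at most two, one for each letter at place `i + 1`. So every column of
`[B_i]_{B_(i+1)}` has at most two nonzero entries, and multiplication by it costs at most
`2 * (n choose k)` operations.
-/

namespace JohnsonFFT

open Equiv
open scoped Finset

section BooleanLattice

variable {α : Type*} [DecidableEq α]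

/-- The down operator of the Boolean lattice on functions of finite sets, with steps in `s`. -/
def downSum {M : Type*} [AddCommMonoid M] (s : Finset α) (g : Finset α → M) (z : Finset α) : M :=
  ∑ a ∈ s \ z, g (insert a z)

/-- The up operator of the Boolean lattice on functions of finite sets, with steps in `s`; it is
the adjoint of `downSum s`. -/
def upSum {M : Type*} [AddCommMonoid M] (s : Finset α) (g : Finset α → M) (u : Finset α) : M :=
  ∑ a ∈ s ∩ u, g (u.erase a)

theorem downSum_upSum_add_card_smul {M : Type*} [AddCommMonoid M] (s : Finset α)
    (g : Finset α → M) (x : Finset α) :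
    downSum s (upSum s g) x + #(s ∩ x) • g x = upSum s (downSum s g) x + #(s \ x) • g x := by
  have hdown : downSum s (upSum s g) x =
      #(s \ x) • g x + ∑ a ∈ s \ x, ∑ b ∈ s ∩ x, g ((insert a x).erase b) := by
    rw [downSum, ← Finset.sum_const, ← Finset.sum_add_distrib]
    refine Finset.sum_congr rfl fun a ha => ?_
    rw [Finset.mem_sdiff] at ha
    rw [upSum, Finset.inter_insert_of_mem ha.1, Finset.sum_insert (by simp [ha.2]),
      Finset.erase_insert ha.2]
  have hup : upSum s (downSum s g) x =
      #(s ∩ x) • g x + ∑ b ∈ s ∩ x, ∑ a ∈ s \ x, g (insert a (x.erase b)) := by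
    rw [upSum, ← Finset.sum_const, ← Finset.sum_add_distrib]
    refine Finset.sum_congr rfl fun b hb => ?_
    rw [Finset.mem_inter] at hb
    rw [downSum, Finset.sdiff_erase hb.1, Finset.sum_insert (by simp [hb.2]),
      Finset.insert_erase hb.2]
  have hcomm : ∑ a ∈ s \ x, ∑ b ∈ s ∩ x, g ((insert a x).erase b) =
      ∑ b ∈ s ∩ x, ∑ a ∈ s \ x, g (insert a (x.erase b)) := by
    rw [Finset.sum_comm]
    refine Finset.sum_congr rfl fun b hb => Finset.sum_congr rfl fun a ha => ?_
    have hab : a ≠ b := by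
      rintro rfl
      exact (Finset.mem_sdiff.1 ha).2 (Finset.mem_inter.1 hb).2
    rw [Finset.erase_insert_of_ne hab]
  rw [hdown, hup, hcomm]
  abel

variable {E : Type*} [NormedAddCommGroup E] [InnerProductSpace ℝ E]

theorem sum_inner_downSum [Fintype α] (s : Finset α) (g h : Finset α → E) :
    ∑ z, inner ℝ (downSum s g z) (h z) = ∑ x, inner ℝ (g x) (upSum s h x) := by
  have hleft (z : Finset α) : inner ℝ (downSum s g z) (h z) =
      ∑ a ∈ s, if a ∉ z then inner ℝ (g (insert a z)) (h z) else 0 := by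
    rw [downSum, sum_inner, ← Finset.sum_filter, Finset.sdiff_eq_filter]
  have hright (x : Finset α) : inner ℝ (g x) (upSum s h x) =
      ∑ a ∈ s, if a ∈ x then inner ℝ (g x) (h (x.erase a)) else 0 := by
    rw [upSum, inner_sum, ← Finset.sum_filter, Finset.filter_mem_eq_inter]
  simp only [hleft, hright]
  rw [Finset.sum_comm, Finset.sum_comm (s := Finset.univ)]
  refine Finset.sum_congr rfl fun a _ => ?_
  rw [← Finset.sum_filter, ← Finset.sum_filter]
  refine Finset.sum_nbij' (insert a) (Finset.erase · a) ?_ ?_ ?_ ?_ ?_ <;>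
    simp +contextual [Finset.insert_erase]

theorem eq_zero_of_downSum_eq_zero [Finite α] {s : Finset α} {g : Finset α → E}
    (h0 : downSum s g = 0) (hg : ∀ x, g x ≠ 0 → #s < 2 * #(s ∩ x)) : g = 0 := by
  have := Fintype.ofFinite α
  have hcomm (x : Finset α) :
      downSum s (upSum s g) x = -(((2 * #(s ∩ x) : ℝ) - #s) • g x) := by
    have h := downSum_upSum_add_card_smul s g x
    have hcard : (#s : ℝ) = #(s ∩ x) + #(s \ x) := by
      exact_mod_cast (Finset.card_inter_add_card_sdiff s x).symm
    rw [h0, show upSum s (0 : Finset α → E) x = 0 from Finset.sum_const_zero, zero_add,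
      ← Nat.cast_smul_eq_nsmul ℝ, ← Nat.cast_smul_eq_nsmul ℝ] at h
    rw [eq_sub_of_add_eq h, hcard]
    module
  have hsum : ∑ x, (‖upSum s g x‖ ^ 2 + ((2 * #(s ∩ x) : ℝ) - #s) * ‖g x‖ ^ 2) = 0 := by
    rw [Finset.sum_add_distrib]
    simp only [← real_inner_self_eq_norm_sq]
    rw [← sum_inner_downSum, ← Finset.sum_add_distrib]
    refine Finset.sum_eq_zero fun x _ => ?_
    rw [hcomm, inner_neg_left, real_inner_smul_left, neg_add_cancel]
  have hpos (x : Finset α) (hx : g x ≠ 0) : (0 : ℝ) < 2 * #(s ∩ x) - #s :=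
    sub_pos.2 (by exact_mod_cast hg x hx)
  have hnonneg (x : Finset α) : 0 ≤ ((2 * #(s ∩ x) : ℝ) - #s) * ‖g x‖ ^ 2 := by
    by_cases hx : g x = 0
    · simp [hx]
    · have := hpos x hx
      positivity
  funext x
  by_contra hx
  have hterm := (Finset.sum_eq_zero_iff_of_nonneg
    fun x _ => add_nonneg (sq_nonneg _) (hnonneg x)).1 hsum x (Finset.mem_univ x)
  have := mul_pos (hpos x hx) (pow_pos (norm_pos_iff.2 hx) 2)
  linarith [sq_nonneg ‖upSum s g x‖]

end BooleanLattice

section FunctionRep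

variable (𝕜 : Type*) [RCLike 𝕜] {G : Type*} [Group G] (X : Type*) [MulAction G X]

/-- The representation `σ f = f ∘ σ⁻¹` of a group on the functions on a set it acts on. The scalars
are a parameter since the real representation yields real bases. -/
def functionRep : Representation 𝕜 G (EuclideanSpace 𝕜 X) where
  toFun σ :=
    { toFun := fun f => WithLp.toLp 2 fun x => f (σ⁻¹ • x)
      map_add' := fun _ _ => rfl
      map_smul' := fun _ _ => rfl }
  map_one' := by
    ext f x
    simp
  map_mul' σ τ := by
    ext f x
    change f ((σ * τ)⁻¹ • x) = f (τ⁻¹ • σ⁻¹ • x)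
    rw [mul_inv_rev, mul_smul]

variable {X}

/-- Multiplication by the indicator function of a set. -/
noncomputable def indicatorMap (A : Set X) : Module.End 𝕜 (EuclideanSpace 𝕜 X) where
  toFun f := WithLp.toLp 2 (A.indicator f)
  map_add' f g := by
    ext x
    by_cases hx : x ∈ A <;> simp [hx]
  map_smul' c f := by
    ext x
    by_cases hx : x ∈ A <;> simp [hx]

variable {𝕜}

theorem functionRep_apply (σ : G) (f : EuclideanSpace 𝕜 X) (x : X) :
    functionRep 𝕜 X σ f x = f (σ⁻¹ • x) := rfl

theorem indicatorMap_apply (A : Set X) (f : EuclideanSpace 𝕜 X) (x : X) :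
    indicatorMap 𝕜 A f x = A.indicator f x := rfl

theorem inner_functionRep [Fintype X] (σ : G) (f g : EuclideanSpace 𝕜 X) :
    inner 𝕜 (functionRep 𝕜 X σ f) g = inner 𝕜 f (functionRep 𝕜 X σ⁻¹ g) := by
  rw [PiLp.inner_apply, PiLp.inner_apply, ← Equiv.sum_comp (MulAction.toPerm σ)]
  simp [functionRep_apply]

theorem indicatorMap_isSymmetric [Fintype X] (A : Set X) : (indicatorMap 𝕜 A).IsSymmetric := by
  intro f g
  simp only [PiLp.inner_apply, indicatorMap_apply]
  refine Finset.sum_congr rfl fun x _ => ?_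
  by_cases hx : x ∈ A <;> simp [hx]

theorem indicatorMap_commute (A B : Set X) :
    Commute (indicatorMap 𝕜 A) (indicatorMap 𝕜 B) := by
  refine LinearMap.ext fun f => ?_
  ext x
  by_cases hA : x ∈ A <;> by_cases hB : x ∈ B <;> simp [indicatorMap_apply, hA, hB]

theorem functionRep_commute_indicatorMap {σ : G} {A : Set X} (hA : ∀ x, σ⁻¹ • x ∈ A ↔ x ∈ A) :
    Commute (functionRep 𝕜 X σ) (indicatorMap 𝕜 A) := by
  refine LinearMap.ext fun f => ?_
  ext x
  by_cases hx : x ∈ A <;> simp [functionRep_apply, indicatorMap_apply, hA, hx]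

theorem indicatorMap_eq_zero_iff {A : Set X} {f : EuclideanSpace 𝕜 X} :
    indicatorMap 𝕜 A f = 0 ↔ ∀ x, f x ≠ 0 → x ∉ A := by
  refine PiLp.ext_iff.trans (forall_congr' fun x => ?_)
  by_cases hx : x ∈ A <;> simp [indicatorMap_apply, hx]

theorem indicatorMap_add_indicatorMap_compl (A : Set X) (f : EuclideanSpace 𝕜 X) :
    indicatorMap 𝕜 A f + indicatorMap 𝕜 Aᶜ f = f := by
  ext x
  by_cases hx : x ∈ A <;> simp [indicatorMap_apply, hx]

theorem mem_iff_mem_of_indicatorMap_eq_smul {A : Set X} {f : EuclideanSpace 𝕜 X} {c : 𝕜}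
    (hf : indicatorMap 𝕜 A f = c • f) {x y : X} (hx : f x ≠ 0) (hy : f y ≠ 0) :
    x ∈ A ↔ y ∈ A := by
  have heigen {z : X} (hz : f z ≠ 0) : z ∈ A ↔ c = 1 := by
    have h : A.indicator f z = c * f z := congrFun (congrArg WithLp.ofLp hf) z
    constructor
    · intro hzA
      rw [Set.indicator_of_mem hzA] at h
      exact (mul_eq_right₀ hz).1 h.symm
    · rintro rfl
      by_contra hzA
      rw [Set.indicator_of_notMem hzA, one_mul] at h
      exact hz h.symm
  rw [heigen hx, heigen hy]

end FunctionRep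

section Transpositions

variable {α : Type*} [DecidableEq α] (𝕜 : Type*) [RCLike 𝕜] (X : Type*) [MulAction (Perm α) X]

/-- The sum of the operators of the transpositions of `s`, over ordered pairs and including the
trivial ones, so that it is invariant under the permutations of `s` term by term. -/
noncomputable def swapSum (s : Finset α) : Module.End 𝕜 (EuclideanSpace 𝕜 X) :=
  ∑ a ∈ s, ∑ b ∈ s, functionRep 𝕜 X (swap a b)

/-- The Jucys–Murphy operator: the sum of the operators of the transpositions that move `p` to an
element of `s`. -/
noncomputable def jucysMurphy (s : Finset α) (p : α) : Module.End 𝕜 (EuclideanSpace 𝕜 X) :=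
  ∑ a ∈ s, functionRep 𝕜 X (swap a p)

variable {𝕜 X} {s t : Finset α}

theorem swapSum_empty : swapSum 𝕜 X (∅ : Finset α) = 0 := Finset.sum_empty

theorem swapSum_singleton (p : α) : swapSum 𝕜 X {p} = 1 := by
  rw [swapSum, Finset.sum_singleton, Finset.sum_singleton, swap_self]
  exact map_one (functionRep 𝕜 X)

theorem jucysMurphy_apply (s : Finset α) (p : α) (f : EuclideanSpace 𝕜 X) (x : X) :
    jucysMurphy 𝕜 X s p f x = ∑ a ∈ s, f (swap a p • x) := by
  simp [jucysMurphy, functionRep_apply]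

theorem swapSum_isSymmetric [Fintype X] (s : Finset α) : (swapSum 𝕜 X s).IsSymmetric := by
  refine LinearMap.isSymmetric_sum _ fun a _ => LinearMap.isSymmetric_sum _ fun b _ f g => ?_
  rw [inner_functionRep, swap_inv]

theorem functionRep_commute_swapSum {τ : Perm α} (hτ : ∀ a, τ a ∈ s ↔ a ∈ s) :
    Commute (functionRep 𝕜 X τ) (swapSum 𝕜 X s) := by
  simp only [Commute, SemiconjBy, swapSum, Finset.mul_sum, Finset.sum_mul, ← map_mul]
  refine Finset.sum_equiv τ (fun a => (hτ a).symm) fun a _ => ?_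
  refine Finset.sum_equiv τ (fun b => (hτ b).symm) fun b _ => ?_
  rw [mul_swap_eq_swap_mul]

theorem swap_mem_iff {a b : α} (ha : a ∈ s) (hb : b ∈ s) (m : α) : swap a b m ∈ s ↔ m ∈ s := by
  rw [swap_apply_def]
  split_ifs with hma hmb
  · simp [hma, ha, hb]
  · simp [hmb, ha, hb]
  · rfl

theorem swapSum_commute_of_subset (hst : s ⊆ t) :
    Commute (swapSum 𝕜 X s) (swapSum 𝕜 X t) :=
  Commute.sum_left _ _ _ fun _ ha => Commute.sum_left _ _ _ fun _ hb =>
    functionRep_commute_swapSum (swap_mem_iff (hst ha) (hst hb))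

theorem swapSum_commute_indicatorMap {A : Set X}
    (hA : ∀ a ∈ s, ∀ b ∈ s, ∀ x, swap a b • x ∈ A ↔ x ∈ A) :
    Commute (swapSum 𝕜 X s) (indicatorMap 𝕜 A) :=
  Commute.sum_left _ _ _ fun a ha => Commute.sum_left _ _ _ fun b hb =>
    functionRep_commute_indicatorMap (by simpa using hA a ha b hb)

theorem swapSum_insert {p : α} (hp : p ∉ s) :
    swapSum 𝕜 X (insert p s) = swapSum 𝕜 X s + (2 : 𝕜) • jucysMurphy 𝕜 X s p + 1 := by
  have hrefl : functionRep 𝕜 X (Equiv.refl α) = 1 := map_one (functionRep 𝕜 X)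
  simp only [swapSum, jucysMurphy, Finset.sum_insert hp, Finset.sum_add_distrib, swap_self,
    swap_comm p, hrefl]
  module

theorem jucysMurphy_eq_smul_of_swapSum_eq_smul {p : α} (hp : p ∉ s) {f : EuclideanSpace 𝕜 X}
    {c d : 𝕜} (hc : swapSum 𝕜 X s f = c • f) (hd : swapSum 𝕜 X (insert p s) f = d • f) :
    jucysMurphy 𝕜 X s p f = ((d - c - 1) / 2) • f := by
  rw [swapSum_insert hp] at hd
  simp only [LinearMap.add_apply, LinearMap.smul_apply, Module.End.one_apply, hc] at hd
  have hJ : (2 : 𝕜) • jucysMurphy 𝕜 X s p f = (d - c - 1) • f := by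
    rw [sub_smul, sub_smul, ← hd]
    module
  rw [div_eq_inv_mul, mul_smul, ← hJ, inv_smul_smul₀ two_ne_zero]

end Transpositions

section SubsetsOfFixedCard

open Set (powersetCard)

variable {α : Type*} [DecidableEq α] {𝕜 : Type*} [RCLike 𝕜] {k : ℕ} {s : Finset α} {p : α}
  {x y : powersetCard α k} {f g : EuclideanSpace 𝕜 (powersetCard α k)}

theorem mem_swap_smul (a b m : α) (x : powersetCard α k) : m ∈ swap a b • x ↔ swap a b m ∈ x := by
  rw [← powersetCard.mem_coe_iff, ← powersetCard.mem_coe_iff, powersetCard.coe_smul,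
    ← Finset.inv_smul_mem_iff]
  simp

theorem swap_smul_eq_self {a b : α} (h : a ∈ x ↔ b ∈ x) : swap a b • x = x := by
  refine SetLike.ext fun m => ?_
  rw [mem_swap_smul, swap_apply_def]
  split_ifs with hma hmb
  · rw [hma, h]
  · rw [hmb, h]
  · rfl

theorem mem_swap_smul_of_notMem {a b m : α} (ha : a ∈ s) (hb : b ∈ s) (hm : m ∉ s)
    (x : powersetCard α k) : m ∈ swap a b • x ↔ m ∈ x := by
  rw [mem_swap_smul, swap_apply_of_ne_of_ne] <;> rintro rfl <;> contradiction

theorem jucysMurphy_apply_eq_card_smul (hf : ∀ y, f y ≠ 0 → (p ∈ y ↔ p ∈ x)) :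
    jucysMurphy 𝕜 _ s p f x = #{a ∈ s | a ∈ (x : Finset α) ↔ p ∈ (x : Finset α)} • f x := by
  rw [jucysMurphy_apply, ← Finset.sum_const, Finset.sum_filter]
  refine Finset.sum_congr rfl fun a _ => ?_
  split_ifs with ha
  · rw [swap_smul_eq_self ha]
  · by_contra hfa
    have := hf _ hfa
    rw [mem_swap_smul, swap_apply_right] at this
    exact ha this

theorem card_eq_of_jucysMurphy_eq_smul {μ : 𝕜} (hμ : jucysMurphy 𝕜 _ s p f = μ • f)
    (hx : f x ≠ 0) (hf : ∀ y, f y ≠ 0 → (p ∈ y ↔ p ∈ x)) :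
    (#{a ∈ s | a ∈ (x : Finset α) ↔ p ∈ (x : Finset α)} : 𝕜) = μ := by
  have h := jucysMurphy_apply_eq_card_smul (s := s) hf
  rw [hμ, PiLp.smul_apply, smul_eq_mul, nsmul_eq_mul] at h
  exact (mul_right_cancel₀ hx h).symm

theorem coe_swap_smul_of_coe_eq_insert {a : α} {z : Finset α} (hx : (x : Finset α) = insert p z)
    (hp : p ∉ z) (ha : a ∉ z) :
    (swap a p • x : powersetCard α k) = insert a z := by
  ext m
  rw [powersetCard.mem_coe_iff, mem_swap_smul, ← powersetCard.mem_coe_iff, hx]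
  simp only [Finset.mem_insert, swap_apply_def]
  grind

theorem downSum_extend_eq_jucysMurphy_apply {z : Finset α} (hx : (x : Finset α) = insert p z)
    (hp : p ∉ z) (hgx : g x = 0) :
    downSum s (Function.extend Subtype.val g (0 : Finset α → 𝕜)) z = jucysMurphy 𝕜 _ s p g x := by
  have hfix (a : α) (ha : a ∈ z) : g (swap a p • x) = 0 := by
    have hmem (m : α) : m ∈ x ↔ m ∈ insert p z := by rw [← powersetCard.mem_coe_iff, hx]
    rw [swap_smul_eq_self (by simp [hmem, ha]), hgx]
  rw [jucysMurphy_apply, downSum, ← Finset.sum_inter_add_sum_sdiff s z,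
    Finset.sum_eq_zero (s := s ∩ z) fun a ha => hfix a (Finset.mem_inter.1 ha).2, zero_add]
  refine Finset.sum_congr rfl fun a ha => ?_
  rw [← coe_swap_smul_of_coe_eq_insert hx hp (Finset.mem_sdiff.1 ha).2]
  exact Subtype.val_injective.extend_apply g 0 (swap a p • x)

theorem eq_zero_of_jucysMurphy_eq_smul [Finite α] {μ : 𝕜}
    (hμ : jucysMurphy 𝕜 _ s p g = μ • g) (hp : ∀ x, g x ≠ 0 → p ∉ x)
    (hg : ∀ x : powersetCard α k, g x ≠ 0 → #s < 2 * #(s ∩ (x : Finset α))) : g = 0 := by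
  let G : Finset α → 𝕜 := Function.extend Subtype.val g 0
  have hG (x : powersetCard α k) : G x = g x := Subtype.val_injective.extend_apply g 0 x
  have exists_of_ne_zero {z : Finset α} (hz : G z ≠ 0) :
      ∃ x : powersetCard α k, g x ≠ 0 ∧ (x : Finset α) = z := by
    obtain ⟨x, rfl⟩ : ∃ x : powersetCard α k, (x : Finset α) = z := by
      by_contra hx
      exact hz (Function.extend_apply' _ _ z hx)
    exact ⟨x, hG x ▸ hz, rfl⟩
  have hdown : downSum s G = 0 := by
    funext z
    by_cases hz : p ∉ z ∧ ∃ x : powersetCard α k, (x : Finset α) = insert p z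
    · obtain ⟨hpz, x, hx⟩ := hz
      have hgx : g x = 0 := not_not.1 fun h => hp x h
        (powersetCard.mem_coe_iff.1 (hx ▸ Finset.mem_insert_self p z))
      rw [downSum_extend_eq_jucysMurphy_apply hx hpz hgx, hμ, PiLp.smul_apply, hgx, smul_zero,
        Pi.zero_apply]
    · refine Finset.sum_eq_zero fun a ha => not_not.1 fun h => hz ?_
      obtain ⟨y, hgy, hy⟩ := exists_of_ne_zero h
      have hpz : p ∉ z := fun h => hp y hgy
        (powersetCard.mem_coe_iff.1 (hy ▸ Finset.mem_insert_of_mem h))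
      refine ⟨hpz, ⟨insert p z, ?_⟩, rfl⟩
      rw [powersetCard.mem_iff, Finset.card_insert_of_notMem hpz,
        ← Finset.card_insert_of_notMem (Finset.mem_sdiff.1 ha).2, ← hy]
      exact y.2
  have hG_eq : G = 0 := by
    refine eq_zero_of_downSum_eq_zero hdown fun z hz => ?_
    obtain ⟨x, hgx, rfl⟩ := exists_of_ne_zero hz
    exact hg x hgx
  ext x
  rw [← hG, hG_eq]
  rfl

theorem card_inter_add_one_eq (hps : p ∉ s) (h : ∀ m ∉ insert p s, (m ∈ x ↔ m ∈ y))
    (hx : p ∈ x) (hy : p ∉ y) :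
    #(s ∩ (x : Finset α)) + 1 = #(s ∩ (y : Finset α)) := by
  have hrest : (x : Finset α) \ insert p s = (y : Finset α) \ insert p s := by
    ext m
    rw [Finset.mem_sdiff, Finset.mem_sdiff]
    exact and_congr_left (h m)
  have hxk := Finset.card_inter_add_card_sdiff (x : Finset α) (insert p s)
  have hyk := Finset.card_inter_add_card_sdiff (y : Finset α) (insert p s)
  rw [powersetCard.card_eq, Finset.inter_comm, hrest,
    Finset.insert_inter_of_mem (powersetCard.mem_coe_iff.2 hx),
    Finset.card_insert_of_notMem (by simp [hps])] at hxk
  rw [powersetCard.card_eq, Finset.inter_comm,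
    Finset.insert_inter_of_notMem (mt powersetCard.mem_coe_iff.1 hy)] at hyk
  omega

theorem eq_zero_or_eq_zero_of_opposite_letters [Finite α] {c d : 𝕜}
    (hps : p ∉ s) (hfc : swapSum 𝕜 _ s f = c • f) (hfd : swapSum 𝕜 _ (insert p s) f = d • f)
    (hgc : swapSum 𝕜 _ s g = c • g) (hgd : swapSum 𝕜 _ (insert p s) g = d • g)
    (hf : ∀ x, f x ≠ 0 → p ∈ x) (hg : ∀ x, g x ≠ 0 → p ∉ x)
    (hfg : ∀ x y, f x ≠ 0 → g y ≠ 0 → ∀ m ∉ insert p s, (m ∈ x ↔ m ∈ y)) : f = 0 ∨ g = 0 := by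
  refine or_iff_not_imp_left.2 fun hf0 => ?_
  obtain ⟨x, hx⟩ : ∃ x, f x ≠ 0 := by
    by_contra! h
    exact hf0 (PiLp.ext h)
  have hfμ := jucysMurphy_eq_smul_of_swapSum_eq_smul hps hfc hfd
  have hgμ := jucysMurphy_eq_smul_of_swapSum_eq_smul hps hgc hgd
  refine eq_zero_of_jucysMurphy_eq_smul hgμ hg fun y hy => ?_
  have hxμ := card_eq_of_jucysMurphy_eq_smul hfμ hx fun z hz => iff_of_true (hf z hz) (hf x hx)
  have hyμ := card_eq_of_jucysMurphy_eq_smul hgμ hy fun z hz => iff_of_false (hg z hz) (hg y hy)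
  have hcard : #(s ∩ (x : Finset α)) = #(s \ (y : Finset α)) := by
    have h := hxμ.trans hyμ.symm
    simp only [powersetCard.mem_coe_iff.2 (hf x hx),
      mt powersetCard.mem_coe_iff.1 (hg y hy), iff_true, iff_false] at h
    rw [← Finset.filter_mem_eq_inter, Finset.sdiff_eq_filter]
    exact_mod_cast h
  have hinter := card_inter_add_one_eq hps (hfg x y hx hy) (hf x hx) (hg y hy)
  have := Finset.card_inter_add_card_sdiff s (y : Finset α)
  omega

end SubsetsOfFixedCard

section JointEigenspaces

variable {n k : ℕ}

/-- The set of the first `j` places. -/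
def firstPlaces (n j : ℕ) : Finset (Fin n) := {m | (m : ℕ) < j}

theorem mem_firstPlaces {j : ℕ} {m : Fin n} : m ∈ firstPlaces n j ↔ (m : ℕ) < j := by
  simp [firstPlaces]

theorem firstPlaces_mono {i j : ℕ} (hij : i ≤ j) : firstPlaces n i ⊆ firstPlaces n j :=
  fun _ hm => mem_firstPlaces.2 ((mem_firstPlaces.1 hm).trans_le hij)

theorem firstPlaces_zero : firstPlaces n 0 = ∅ := by
  simp [firstPlaces]

theorem firstPlaces_succ (p : Fin n) : firstPlaces n (p + 1) = insert p (firstPlaces n p) := by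
  ext m
  rw [Finset.mem_insert, mem_firstPlaces, mem_firstPlaces, Fin.ext_iff]
  lia

theorem firstPlaces_one (hn : 1 ≤ n) : firstPlaces n 1 = {⟨0, hn⟩} := by
  rw [firstPlaces_succ ⟨0, hn⟩, firstPlaces_zero, insert_empty_eq]

theorem mem_suffixSpace {i : ℕ} {w : Finset (Fin n)} {f : FunSpace n k} :
    f ∈ suffixSpace n k i w ↔ ∀ x, f x ≠ 0 → ∀ m : Fin n, i ≤ (m : ℕ) → (m ∈ x ↔ m ∈ w) := by
  rw [suffixSpace, ← OrthonormalBasis.coe_toBasis, Module.Basis.mem_span_image]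
  simp only [Set.subset_def, Finset.mem_coe, Finsupp.mem_support_iff]
  rfl

/-- The joint eigenspace of the transposition sums of `S_0, …, S_j`, with the eigenvalues
`c 0, …, c j`, in the space of the words that agree with `w` at all places after the first `i`. -/
noncomputable def jointEigenspace (n k i j : ℕ) (c : ℕ → ℂ) (w : Finset (Fin n)) :
    Submodule ℂ (FunSpace n k) :=
  (⨅ l ∈ Finset.Iic j, Module.End.eigenspace (swapSum ℂ (KSet n k) (firstPlaces n l)) (c l)) ⊓
    suffixSpace n k i w

variable {i j i' j' : ℕ} {c d : ℕ → ℂ} {v w : Finset (Fin n)}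

theorem mem_jointEigenspace {f : FunSpace n k} :
    f ∈ jointEigenspace n k i j c w ↔
      (∀ l ≤ j, swapSum ℂ (KSet n k) (firstPlaces n l) f = c l • f) ∧
        f ∈ suffixSpace n k i w := by
  simp [jointEigenspace, Submodule.mem_iInf]

theorem jointEigenspace_le_jointEigenspace (hi : i ≤ i') (hj : j' ≤ j)
    (hcd : ∀ l ≤ j', c l = d l) (hwv : ∀ m : Fin n, i' ≤ (m : ℕ) → (m ∈ w ↔ m ∈ v)) :
    jointEigenspace n k i j c w ≤ jointEigenspace n k i' j' d v := by
  intro f hf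
  rw [mem_jointEigenspace, mem_suffixSpace] at hf ⊢
  exact ⟨fun l hl => hcd l hl ▸ hf.1 l (hl.trans hj),
    fun x hx m hm => (hf.2 x hx m (hi.trans hm)).trans (hwv m hm)⟩

theorem eigenvalue_eq_of_inner_ne_zero {f g : FunSpace n k}
    (hf : f ∈ jointEigenspace n k i j c w) (hg : g ∈ jointEigenspace n k i' j' d v)
    (hfg : inner ℂ f g ≠ 0) {l : ℕ} (hl : l ≤ j) (hl' : l ≤ j') : c l = d l := by
  by_contra hne
  exact hfg ((swapSum_isSymmetric _).orthogonalFamily_eigenspaces hne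
    ⟨f, Module.End.mem_eigenspace_iff.2 ((mem_jointEigenspace.1 hf).1 l hl)⟩
    ⟨g, Module.End.mem_eigenspace_iff.2 ((mem_jointEigenspace.1 hg).1 l hl')⟩)

theorem letter_iff_of_inner_ne_zero {f g : FunSpace n k}
    (hf : f ∈ suffixSpace n k i w) (hg : g ∈ suffixSpace n k i' v)
    (hfg : inner ℂ f g ≠ 0) {m : Fin n} (hm : i ≤ (m : ℕ)) (hm' : i' ≤ (m : ℕ)) :
    m ∈ w ↔ m ∈ v := by
  rw [PiLp.inner_apply] at hfg
  obtain ⟨x, -, hx⟩ := Finset.exists_ne_zero_of_sum_ne_zero hfg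
  have hfx : f x ≠ 0 := fun h => hx (by simp [h])
  have hgx : g x ≠ 0 := fun h => hx (by simp [h])
  exact (mem_suffixSpace.1 hf x hfx m hm).symm.trans (mem_suffixSpace.1 hg x hgx m hm')

theorem indicatorMap_mem_jointEigenspace {p : Fin n} (hj : j ≤ p)
    (hwv : ∀ m, p < m → (m ∈ w ↔ m ∈ v)) {A : Set (KSet n k)}
    (hA : ∀ x, x ∈ A ↔ (p ∈ x ↔ p ∈ v)) {f : FunSpace n k}
    (hf : f ∈ jointEigenspace n k (p + 1) j c w) :
    indicatorMap ℂ A f ∈ jointEigenspace n k p j c v := by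
  rw [mem_jointEigenspace, mem_suffixSpace] at hf ⊢
  refine ⟨fun l hl => ?_, fun x hx m hm => ?_⟩
  · have hp : p ∉ firstPlaces n l := fun h => by
      have := mem_firstPlaces.1 h
      lia
    have hcomm : Commute (swapSum ℂ (KSet n k) (firstPlaces n l)) (indicatorMap ℂ A) :=
      swapSum_commute_indicatorMap fun a ha b hb x => by
        rw [hA, hA, mem_swap_smul_of_notMem ha hb hp]
    rw [← Module.End.mul_apply, hcomm.eq, Module.End.mul_apply, hf.1 l hl, map_smul]
  · have hxA : x ∈ A := Set.mem_of_indicator_ne_zero hx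
    rw [indicatorMap_apply, Set.indicator_of_mem hxA] at hx
    rcases (Fin.le_def.2 hm).eq_or_lt with rfl | hpm
    · exact (hA x).1 hxA
    · exact (hf.2 x hx m hpm).trans (hwv m hpm)

theorem indicatorMap_mem_jointEigenspace_insert {p : Fin n} (hj : j ≤ p) {f : FunSpace n k}
    (hf : f ∈ jointEigenspace n k (p + 1) j c w) :
    indicatorMap ℂ {x | p ∈ x} f ∈ jointEigenspace n k p j c (insert p w) :=
  indicatorMap_mem_jointEigenspace hj (fun m hm => by simp [hm.ne']) (fun x => by simp) hf

theorem indicatorMap_compl_mem_jointEigenspace_erase {p : Fin n} (hj : j ≤ p) {f : FunSpace n k}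
    (hf : f ∈ jointEigenspace n k (p + 1) j c w) :
    indicatorMap ℂ {x | p ∈ x}ᶜ f ∈ jointEigenspace n k p j c (w.erase p) :=
  indicatorMap_mem_jointEigenspace hj (fun m hm => by simp [hm.ne']) (fun x => by simp) hf

theorem finrank_suffixSpace_zero_le_one (w : Finset (Fin n)) :
    Module.finrank ℂ (suffixSpace n k 0 w) ≤ 1 := by
  have hsub : {x : KSet n k | ∀ m : Fin n, 0 ≤ (m : ℕ) →
      (m ∈ (x : Finset (Fin n)) ↔ m ∈ w)}.Subsingleton := fun x hx y hy =>
    SetLike.ext fun m => (hx m m.val.zero_le).trans (hy m m.val.zero_le).symm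
  rw [suffixSpace]
  rcases hsub.eq_empty_or_singleton with h | ⟨x, h⟩
  · rw [h, Set.image_empty, Submodule.span_empty, finrank_bot]
    exact zero_le_one
  · rw [h, Set.image_singleton, finrank_span_singleton ((deltaBasis n k).orthonormal.ne_zero x)]

theorem exists_mem_ne_zero_of_finrank_lt {K E : Type*} [Field K] [AddCommGroup E] [Module K E]
    [FiniteDimensional K E] {V W : Submodule K E}
    (hVW : Module.finrank K W < Module.finrank K V) (P : Module.End K E)
    (hP : ∀ v ∈ V, P v ∈ W) : ∃ v ∈ V, v ≠ 0 ∧ P v = 0 := by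
  have hker := LinearMap.ker_ne_bot_of_finrank_lt (f := P.restrict hP) hVW
  obtain ⟨v, hv, hv0⟩ := Submodule.exists_mem_ne_zero_of_ne_bot hker
  exact ⟨v, v.2, fun h => hv0 (Subtype.ext h), congrArg Subtype.val (LinearMap.mem_ker.1 hv)⟩

theorem finrank_jointEigenspace_le_one (hi : i ≤ n) (c : ℕ → ℂ) (w : Finset (Fin n)) :
    Module.finrank ℂ (jointEigenspace n k i i c w) ≤ 1 := by
  induction i generalizing w with
  | zero => exact (Submodule.finrank_mono inf_le_right).trans (finrank_suffixSpace_zero_le_one w)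
  | succ i ih =>
    obtain ⟨p, rfl⟩ : ∃ p : Fin n, (p : ℕ) = i := ⟨⟨i, hi⟩, rfl⟩
    by_contra! hV
    have hle : jointEigenspace n k (p + 1) (p + 1) c w ≤ jointEigenspace n k (p + 1) p c w :=
      jointEigenspace_le_jointEigenspace le_rfl p.val.le_succ (fun _ _ => rfl) fun _ _ => Iff.rfl
    obtain ⟨f, hfV, hf0, hf⟩ := exists_mem_ne_zero_of_finrank_lt ((ih (by lia) _).trans_lt hV)
      (indicatorMap ℂ {x | p ∈ x}ᶜ)
      fun f hf => indicatorMap_compl_mem_jointEigenspace_erase le_rfl (hle hf)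
    obtain ⟨g, hgV, hg0, hg⟩ := exists_mem_ne_zero_of_finrank_lt ((ih (by lia) _).trans_lt hV)
      (indicatorMap ℂ {x | p ∈ x})
      fun f hf => indicatorMap_mem_jointEigenspace_insert le_rfl (hle hf)
    rw [indicatorMap_eq_zero_iff] at hf hg
    rw [mem_jointEigenspace, mem_suffixSpace] at hfV hgV
    have hfd := hfV.1 (p + 1) le_rfl
    have hgd := hgV.1 (p + 1) le_rfl
    rw [firstPlaces_succ] at hfd hgd
    have hsame (x y) (hx : f x ≠ 0) (hy : g y ≠ 0) (m) (hm : m ∉ insert p (firstPlaces n p)) :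
        m ∈ x ↔ m ∈ y := by
      rw [← firstPlaces_succ, mem_firstPlaces, not_lt] at hm
      exact (hfV.2 x hx m hm).trans (hgV.2 y hy m hm).symm
    rcases eq_zero_or_eq_zero_of_opposite_letters (by simp [mem_firstPlaces])
      (hfV.1 p p.val.le_succ) hfd (hgV.1 p p.val.le_succ) hgd
      (fun x hx => not_not.1 (hf x hx)) hg hsame with h | h
    · exact hf0 h
    · exact hg0 h

theorem finrank_jointEigenspace_succ_le_two (hi : i < n) (c : ℕ → ℂ) (w : Finset (Fin n)) :
    Module.finrank ℂ (jointEigenspace n k (i + 1) i c w) ≤ 2 := by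
  obtain ⟨p, rfl⟩ : ∃ p : Fin n, (p : ℕ) = i := ⟨⟨i, hi⟩, rfl⟩
  have hle : jointEigenspace n k (p + 1) p c w ≤
      jointEigenspace n k p p c (insert p w) ⊔ jointEigenspace n k p p c (w.erase p) := by
    intro f hf
    rw [← indicatorMap_add_indicatorMap_compl {x | p ∈ x} f]
    exact Submodule.add_mem_sup (indicatorMap_mem_jointEigenspace_insert le_rfl hf)
      (indicatorMap_compl_mem_jointEigenspace_erase le_rfl hf)
  calc Module.finrank ℂ (jointEigenspace n k (p + 1) p c w)
      ≤ _ := (Submodule.finrank_mono hle).trans (Submodule.finrank_add_le_finrank_add_finrank _ _)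
    _ ≤ 1 + 1 := Nat.add_le_add (finrank_jointEigenspace_le_one hi.le c _)
        (finrank_jointEigenspace_le_one hi.le c _)

end JointEigenspaces

section Isotypic

theorem exists_smul_eq_smul_of_mem_isotypicComponents {K A M : Type*} [Field K] [IsAlgClosed K]
    [Ring A] [Algebra K A] [AddCommGroup M] [Module K M] [Module A M] [IsScalarTower K A M]
    [FiniteDimensional K M] {z : A} (hz : ∀ a, Commute z a) {C : Submodule A M}
    (hC : C ∈ isotypicComponents A M) : ∃ c : K, ∀ v ∈ C, z • v = c • v := by
  obtain ⟨S, hS, rfl⟩ := hC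
  have : FiniteDimensional K S := inferInstanceAs (FiniteDimensional K (S.restrictScalars K))
  let zS : Module.End A S :=
    { toFun := fun v => z • v
      map_add' := smul_add z
      map_smul' := fun a v => by
        rw [RingHom.id_apply, smul_smul, smul_smul, (hz a).eq] }
  obtain ⟨c, hc⟩ :=
    (IsSimpleModule.algebraMap_end_bijective_of_isAlgClosed (A := A) (V := S) K).2 zS
  have hzS (v : S) : z • v = c • v := (LinearMap.congr_fun hc v).symm
  refine ⟨c, fun v hv => ?_⟩
  rw [isotypicComponent, sSup_eq_iSup'] at hv
  induction hv using Submodule.iSup_induction' with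
  | mem N v hv =>
    obtain ⟨N, ⟨e⟩⟩ := N
    have : z • (⟨v, hv⟩ : N) = c • ⟨v, hv⟩ := e.injective <| by
      rw [← algebraMap_smul A c, map_smul, map_smul, algebraMap_smul, hzS]
    exact congrArg Subtype.val this
  | zero => simp
  | add u v _ _ hu hv => rw [smul_add, smul_add, hu, hv]

theorem le_iSup_inf_isotypicComponents {A M : Type*} [Ring A] [AddCommGroup M] [Module A M]
    [IsSemisimpleModule A M] (N : Submodule A M) :
    N ≤ ⨆ C ∈ isotypicComponents A M, N ⊓ C :=
  (IsSemisimpleModule.sSup_simples_le N).ge.trans <| sSup_le fun S hS =>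
    le_iSup₂_of_le (isotypicComponent A M S) ⟨S, hS.1, rfl⟩ (le_inf hS.2 S.le_isotypicComponent)

variable {n k i j : ℕ}

theorem mem_symSub {σ : Perm (Fin n)} :
    σ ∈ symSub n j ↔ ∀ m : Fin n, j ≤ (m : ℕ) → σ m = m := by
  simp [symSub, mem_fixingSubgroup_iff]

theorem symSub_mono (h : i ≤ j) : symSub n i ≤ symSub n j := fun _ hσ =>
  mem_symSub.2 fun m hm => mem_symSub.1 hσ m (h.trans hm)

theorem apply_mem_firstPlaces_iff {σ : Perm (Fin n)} (hσ : σ ∈ symSub n j) (m : Fin n) :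
    σ m ∈ firstPlaces n j ↔ m ∈ firstPlaces n j := by
  rw [mem_symSub] at hσ
  rw [mem_firstPlaces, mem_firstPlaces, ← not_le, ← not_le, not_iff_not]
  refine ⟨fun h => ?_, fun h => by rwa [hσ m h]⟩
  rwa [σ.injective (hσ _ h)] at h

theorem swap_mem_symSub {a b : Fin n} (ha : a ∈ firstPlaces n j) (hb : b ∈ firstPlaces n j) :
    swap a b ∈ symSub n j := by
  rw [mem_firstPlaces] at ha hb
  refine mem_symSub.2 fun m hm => swap_apply_of_ne_of_ne ?_ ?_ <;> rintro rfl <;> lia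

theorem exists_central_asAlgebraHom_eq_swapSum (n k j : ℕ) :
    ∃ z : MonoidAlgebra ℂ (symSub n j), (∀ a, Commute z a) ∧
      (subRep n k j).asAlgebraHom z = swapSum ℂ (KSet n k) (firstPlaces n j) := by
  let t (a b : firstPlaces n j) : symSub n j := ⟨swap a b, swap_mem_symSub a.2 b.2⟩
  refine ⟨∑ a, ∑ b, MonoidAlgebra.of ℂ _ (t a b), fun r => ?_, ?_⟩
  · refine MonoidAlgebra.induction_on r (fun σ => ?_) (fun _ _ => Commute.add_right)
      fun c _ h => h.smul_right c
    let τ : Perm (firstPlaces n j) := σ.1.subtypePerm (apply_mem_firstPlaces_iff σ.2)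
    have ht (a b : firstPlaces n j) : σ * t a b = t (τ a) (τ b) * σ :=
      Subtype.ext (mul_swap_eq_swap_mul σ.1 a b)
    simp only [Commute, SemiconjBy, Finset.mul_sum, Finset.sum_mul, ← map_mul, ht]
    symm
    exact Fintype.sum_equiv τ _ _ fun a => Fintype.sum_equiv τ _ _ fun b => rfl
  · simp only [map_sum, Representation.asAlgebraHom_of]
    rw [swapSum, ← Finset.sum_coe_sort (firstPlaces n j)]
    refine Finset.sum_congr rfl fun a _ => ?_
    rw [← Finset.sum_coe_sort (firstPlaces n j)]
    rfl

theorem exists_eigenvalue_of_mem_isotypicSpaces {C : Submodule ℂ (FunSpace n k)}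
    (hC : C ∈ isotypicSpaces n k j) :
    ∃ c : ℂ, ∀ f ∈ C, swapSum ℂ (KSet n k) (firstPlaces n j) f = c • f := by
  obtain ⟨D, hD, rfl⟩ := hC
  obtain ⟨z, hz, hzs⟩ := exists_central_asAlgebraHom_eq_swapSum n k j
  have : FiniteDimensional ℂ (subRep n k j).asModule :=
    inferInstanceAs (FiniteDimensional ℂ (FunSpace n k))
  obtain ⟨c, hc⟩ := exists_smul_eq_smul_of_mem_isotypicComponents (K := ℂ) hz hD
  refine ⟨c, ?_⟩
  rintro _ ⟨v, hv, rfl⟩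
  rw [← hzs]
  exact hc v hv

theorem permRep_mem_of_mem_isotypicSpaces {C : Submodule ℂ (FunSpace n k)}
    (hC : C ∈ isotypicSpaces n k j) {σ : Perm (Fin n)} (hσ : σ ∈ symSub n j) {f : FunSpace n k}
    (hf : f ∈ C) : permRep n k σ f ∈ C := by
  obtain ⟨D, -, rfl⟩ := hC
  obtain ⟨v, hv, rfl⟩ := hf
  refine ⟨MonoidAlgebra.of ℂ (symSub n j) ⟨σ, hσ⟩ • v, D.smul_mem _ hv, ?_⟩
  change (subRep n k j).asAlgebraHom _ v = _
  rw [Representation.asAlgebraHom_of]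
  rfl

theorem le_iSup_inf_isotypicSpaces {M : Submodule ℂ (FunSpace n k)}
    (hM : ∀ σ ∈ symSub n j, ∀ f ∈ M, permRep n k σ f ∈ M) :
    M ≤ ⨆ C ∈ isotypicSpaces n k j, M ⊓ C := by
  let N : Submodule (MonoidAlgebra ℂ (symSub n j)) (subRep n k j).asModule :=
    MonoidAlgebra.submoduleOfSMulMem
      (M.comap (subRep n k j).asModuleEquiv.toLinearMap) fun g v hv => by
        change (subRep n k j).asAlgebraHom _ v ∈ M
        rw [Representation.asAlgebraHom_of]
        exact hM g g.2 v hv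
  intro f hf
  have hfN : (subRep n k j).asModuleEquiv.symm f ∈ N := hf
  have hf' := Submodule.mem_map_of_mem (f := (subRep n k j).asModuleEquiv.toLinearMap)
    ((Submodule.restrictScalars_mem ℂ _ _).2 (le_iSup_inf_isotypicComponents N hfN))
  simp only [Submodule.restrictScalars_iSup, Submodule.map_iSup] at hf'
  refine (iSup₂_le fun C hC => ?_ : _ ≤ ⨆ C ∈ isotypicSpaces n k j, M ⊓ C) hf'
  refine le_iSup₂_of_le _ ⟨C, hC, rfl⟩ ?_
  rintro _ ⟨v, hv, rfl⟩
  exact ⟨hv.1, v, hv.2, rfl⟩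

theorem le_iSup_inf_iInf_isotypicSpaces (i : ℕ) {M : Submodule ℂ (FunSpace n k)}
    (hM : ∀ σ ∈ symSub n i, ∀ f ∈ M, permRep n k σ f ∈ M) :
    M ≤ ⨆ C : {C : ℕ → Submodule ℂ (FunSpace n k) //
      ∀ j ∈ Finset.Icc 1 i, C j ∈ isotypicSpaces n k j}, M ⊓ ⨅ j ∈ Finset.Icc 1 i, C.1 j := by
  induction i generalizing M with
  | zero => exact le_iSup_of_le ⟨fun _ => ⊥, by simp⟩ (by simp)
  | succ i ih =>
    refine (le_iSup_inf_isotypicSpaces hM).trans (iSup₂_le fun D hD => ?_)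
    have hsub := symSub_mono (n := n) i.le_succ
    refine (ih (M := M ⊓ D) fun σ hσ f hf => ⟨hM σ (hsub hσ) f hf.1,
      permRep_mem_of_mem_isotypicSpaces hD (hsub hσ) hf.2⟩).trans (iSup_le fun C => ?_)
    let C' := Function.update C.1 (i + 1) D
    have hC'_last : C' (i + 1) = D := Function.update_self ..
    have hC' {j : ℕ} (hj : j ∈ Finset.Icc 1 i) : C' j = C.1 j :=
      Function.update_of_ne (Nat.lt_succ_of_le (Finset.mem_Icc.1 hj).2).ne _ _
    have hIcc : Finset.Icc 1 (i + 1) = insert (i + 1) (Finset.Icc 1 i) :=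
      (Finset.insert_Icc_right_eq_Icc_add_one (by lia)).symm
    refine le_iSup_of_le ⟨C', ?_⟩ ?_
    · simp only [hIcc, Finset.forall_mem_insert, hC'_last]
      exact ⟨hD, fun j hj => hC' hj ▸ C.2 j hj⟩
    · simp only [hIcc, Finset.iInf_insert, hC'_last, ← inf_assoc]
      exact inf_le_inf_left _ (iInf₂_mono fun j hj => (hC' hj).ge)

theorem permRep_mem_suffixSpace {w : Finset (Fin n)} {σ : Perm (Fin n)}
    (hσ : σ ∈ symSub n i) {f : FunSpace n k} (hf : f ∈ suffixSpace n k i w) :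
    permRep n k σ f ∈ suffixSpace n k i w := by
  rw [mem_suffixSpace] at hf ⊢
  intro x hx m hm
  have hmem : m ∈ σ⁻¹ • x ↔ σ • m ∈ x := by
    rw [← Set.powersetCard.mem_coe_iff, ← Set.powersetCard.mem_coe_iff,
      Set.powersetCard.coe_smul, Finset.mem_inv_smul_finset_iff]
  rw [← hf _ hx m hm, hmem, Perm.smul_def, mem_symSub.1 hσ m hm]

theorem exists_gtSpace_le_jointEigenspace {C : ℕ → Submodule ℂ (FunSpace n k)}
    (hC : ∀ j ∈ Finset.Icc 1 i, C j ∈ isotypicSpaces n k j) (w : Finset (Fin n)) :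
    ∃ c : ℕ → ℂ, gtSpace n k i C w ≤ jointEigenspace n k i i c w := by
  have heigen (l : ℕ) : ∃ c : ℂ, l ≤ i →
      ∀ f ∈ gtSpace n k i C w, swapSum ℂ (KSet n k) (firstPlaces n l) f = c • f := by
    by_cases hl : l ∈ Finset.Icc 1 i
    · obtain ⟨c, hc⟩ := exists_eigenvalue_of_mem_isotypicSpaces (hC l hl)
      exact ⟨c, fun _ f hf => hc f ((iInf₂_le l hl : _ ≤ C l) hf.1)⟩
    · refine ⟨0, fun hli f _ => ?_⟩
      obtain rfl : l = 0 := by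
        rw [Finset.mem_Icc] at hl
        lia
      rw [firstPlaces_zero, swapSum_empty, zero_smul, LinearMap.zero_apply]
  choose c hc using heigen
  exact ⟨c, fun f hf => mem_jointEigenspace.2 ⟨fun l hl => hc l hl f hf, hf.2⟩⟩

theorem finrank_gtSpace_le_one (hi : i ≤ n) {C : ℕ → Submodule ℂ (FunSpace n k)}
    (hC : ∀ j ∈ Finset.Icc 1 i, C j ∈ isotypicSpaces n k j) (w : Finset (Fin n)) :
    Module.finrank ℂ (gtSpace n k i C w) ≤ 1 := by
  obtain ⟨c, hc⟩ := exists_gtSpace_le_jointEigenspace hC w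
  exact (Submodule.finrank_mono hc).trans (finrank_jointEigenspace_le_one hi c w)

theorem exists_mem_gtSpace (hi : i ≤ n) {c : ℕ → ℂ} {w : Finset (Fin n)}
    {v : FunSpace n k} (hv : v ∈ jointEigenspace n k i i c w) (hv0 : v ≠ 0) :
    ∃ C : ℕ → Submodule ℂ (FunSpace n k),
      (∀ j ∈ Finset.Icc 1 i, C j ∈ isotypicSpaces n k j) ∧ v ∈ gtSpace n k i C w := by
  by_contra! hno
  have horth : suffixSpace n k i w ≤ (ℂ ∙ v)ᗮ := by
    refine (le_iSup_inf_iInf_isotypicSpaces i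
      fun σ hσ f hf => permRep_mem_suffixSpace hσ hf).trans (iSup_le ?_)
    rintro ⟨C, hC⟩ u hu
    rw [inf_comm] at hu
    change u ∈ gtSpace n k i C w at hu
    rw [Submodule.mem_orthogonal_singleton_iff_inner_right]
    by_contra hvu
    obtain ⟨d, hd⟩ := exists_gtSpace_le_jointEigenspace hC w
    have hdc (l : ℕ) (hl : l ≤ i) : d l = c l :=
      (eigenvalue_eq_of_inner_ne_zero hv (hd hu) hvu hl hl).symm
    have hu' : u ∈ jointEigenspace n k i i c w :=
      jointEigenspace_le_jointEigenspace le_rfl le_rfl hdc (fun _ _ => Iff.rfl) (hd hu)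
    have hu0 : u ≠ 0 := fun h => hvu (h ▸ inner_zero_right v)
    have hspan : ℂ ∙ u = jointEigenspace n k i i c w :=
      Submodule.eq_of_le_of_finrank_le ((Submodule.span_singleton_le_iff_mem _ _).2 hu')
        ((finrank_jointEigenspace_le_one hi c w).trans_eq (finrank_span_singleton hu0).symm)
    exact hno C hC ((Submodule.span_singleton_le_iff_mem _ _).2 hu (hspan.ge hv))
  exact hv0 (inner_self_eq_zero.1
    (Submodule.mem_orthogonal_singleton_iff_inner_right.1 (horth (mem_jointEigenspace.1 hv).2)))

theorem isGTBasis_iff (hi : i ≤ n) (b : OrthonormalBasis (KSet n k) ℂ (FunSpace n k)) :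
    IsGTBasis n k i b ↔ ∀ x, ∃ c : ℕ → ℂ, ∃ w, b x ∈ jointEigenspace n k i i c w := by
  refine forall_congr' fun x => ⟨?_, ?_⟩
  · rintro ⟨C, w, hC, hx⟩
    obtain ⟨c, hc⟩ := exists_gtSpace_le_jointEigenspace hC w
    exact ⟨c, w, hc hx⟩
  · rintro ⟨c, w, hx⟩
    obtain ⟨C, hC, hx'⟩ := exists_mem_gtSpace hi hx (b.orthonormal.ne_zero x)
    exact ⟨C, w, hC, hx'⟩

end Isotypic

section RealBases

theorem exists_orthonormalBasis_joint_eigenvectors {𝕜 E ι κ : Type*} [RCLike 𝕜]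
    [NormedAddCommGroup E] [InnerProductSpace 𝕜 E] [FiniteDimensional 𝕜 E] [Fintype κ]
    (hκ : Module.finrank 𝕜 E = Fintype.card κ) {T : ι → Module.End 𝕜 E}
    (hT : ∀ i, (T i).IsSymmetric) (hC : Pairwise (Function.onFun Commute T)) :
    ∃ b : OrthonormalBasis κ 𝕜 E, ∀ x, ∃ χ : ι → 𝕜, ∀ i, T i (b x) = χ i • b x := by
  classical
  let V (χ : ι → 𝕜) : Submodule 𝕜 E := ⨅ i, Module.End.eigenspace (T i) (χ i)
  have hV : DirectSum.IsInternal V :=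
    LinearMap.IsSymmetric.directSum_isInternal_of_pairwise_commute hT hC
  have hfin : {χ | V χ ≠ ⊥}.Finite :=
    WellFoundedGT.finite_ne_bot_of_iSupIndep hV.submodule_iSupIndep
  have : Fintype {χ // V χ ≠ ⊥} := hfin.fintype
  have hV' := DirectSum.isInternal_ne_bot_iff.2 hV
  have hO := (LinearMap.IsSymmetric.orthogonalFamily_iInf_eigenspaces hT).comp
    (Subtype.val_injective (p := fun χ => V χ ≠ ⊥))
  refine ⟨(hV'.subordinateOrthonormalBasis hκ hO).reindex (Fintype.equivFin κ).symm, fun x => ?_⟩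
  rw [OrthonormalBasis.reindex_apply, Equiv.symm_symm]
  have hb := hV'.subordinateOrthonormalBasis_subordinate hκ (Fintype.equivFin κ x) hO
  exact ⟨_, fun i => Module.End.mem_eigenspace_iff.1 ((Submodule.mem_iInf _).1 hb i)⟩

section Complexification

variable (𝕜 : Type*) [RCLike 𝕜] {ι : Type*}

/-- A real function regarded as a function with values in `ℝ` or `ℂ`. -/
noncomputable def ofRealFun (f : EuclideanSpace ℝ ι) : EuclideanSpace 𝕜 ι :=
  WithLp.toLp 2 fun x => (f x : 𝕜)

variable {𝕜}

theorem ofRealFun_apply (f : EuclideanSpace ℝ ι) (x : ι) : ofRealFun 𝕜 f x = (f x : 𝕜) := rfl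

theorem ofRealFun_smul (c : ℝ) (f : EuclideanSpace ℝ ι) :
    ofRealFun 𝕜 (c • f) = (c : 𝕜) • ofRealFun 𝕜 f := by
  ext x
  simp [ofRealFun_apply]

theorem swapSum_ofRealFun {α : Type*} [DecidableEq α] [MulAction (Perm α) ι] (s : Finset α)
    (f : EuclideanSpace ℝ ι) : swapSum 𝕜 ι s (ofRealFun 𝕜 f) = ofRealFun 𝕜 (swapSum ℝ ι s f) := by
  ext x
  simp [swapSum, functionRep_apply, ofRealFun_apply]

variable [Fintype ι]

theorem inner_ofRealFun (f g : EuclideanSpace ℝ ι) :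
    inner 𝕜 (ofRealFun 𝕜 f) (ofRealFun 𝕜 g) = ((inner ℝ f g : ℝ) : 𝕜) := by
  simp [PiLp.inner_apply, ofRealFun_apply]

theorem orthonormal_ofRealFun {κ : Type*} {v : κ → EuclideanSpace ℝ ι} (hv : Orthonormal ℝ v) :
    Orthonormal 𝕜 fun x => ofRealFun 𝕜 (v x) := by
  classical
  rw [orthonormal_iff_ite] at hv ⊢
  intro x y
  rw [inner_ofRealFun, hv]
  split_ifs <;> simp

variable (𝕜)

/-- A real orthonormal basis regarded as an orthonormal basis over `ℝ` or `ℂ`. -/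
noncomputable def ofRealBasis (b : OrthonormalBasis ι ℝ (EuclideanSpace ℝ ι)) :
    OrthonormalBasis ι 𝕜 (EuclideanSpace 𝕜 ι) :=
  OrthonormalBasis.mk (orthonormal_ofRealFun b.orthonormal)
    ((orthonormal_ofRealFun b.orthonormal).linearIndependent.span_eq_top_of_card_eq_finrank'
      finrank_euclideanSpace.symm).ge

variable {𝕜}

theorem ofRealBasis_apply (b : OrthonormalBasis ι ℝ (EuclideanSpace ℝ ι)) (x : ι) :
    ofRealBasis 𝕜 b x = ofRealFun 𝕜 (b x) := by
  rw [ofRealBasis, OrthonormalBasis.coe_mk]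

theorem ofRealBasis_basisFun :
    ofRealBasis 𝕜 (EuclideanSpace.basisFun ι ℝ) = EuclideanSpace.basisFun ι 𝕜 := by
  classical
  refine DFunLike.ext _ _ fun x => ?_
  ext y
  rw [ofRealBasis_apply, ofRealFun_apply, EuclideanSpace.basisFun_apply,
    EuclideanSpace.basisFun_apply, PiLp.single_apply, PiLp.single_apply]
  split_ifs <;> simp

end Complexification

variable {n k : ℕ}

theorem swapSum_firstPlaces_commute (l l' : ℕ) : Commute (swapSum ℝ (KSet n k) (firstPlaces n l))
    (swapSum ℝ (KSet n k) (firstPlaces n l')) := by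
  rcases le_total l l' with h | h
  · exact swapSum_commute_of_subset (firstPlaces_mono h)
  · exact (swapSum_commute_of_subset (firstPlaces_mono h)).symm

theorem swapSum_firstPlaces_commute_indicatorMap {l : ℕ} {m : Fin n} (hl : l ≤ (m : ℕ)) :
    Commute (swapSum ℝ (KSet n k) (firstPlaces n l)) (indicatorMap ℝ {x | m ∈ x}) :=
  swapSum_commute_indicatorMap fun _ ha _ hb x =>
    mem_swap_smul_of_notMem ha hb (fun hm => hl.not_gt (mem_firstPlaces.1 hm)) x

theorem exists_real_isGTBasis {i : ℕ} (hi : i ≤ n) :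
    ∃ b : OrthonormalBasis (KSet n k) ℝ (EuclideanSpace ℝ (KSet n k)),
      IsGTBasis n k i (ofRealBasis ℂ b) := by
  let T : Set.Iic i ⊕ {m : Fin n // i ≤ (m : ℕ)} → Module.End ℝ (EuclideanSpace ℝ (KSet n k)) :=
    Sum.elim (fun l => swapSum ℝ (KSet n k) (firstPlaces n l))
      fun m => indicatorMap ℝ {x | (m : Fin n) ∈ x}
  have hT : ∀ t, (T t).IsSymmetric :=
    Sum.rec (fun _ => swapSum_isSymmetric _) fun _ => indicatorMap_isSymmetric _
  have hC : ∀ t t', Commute (T t) (T t') := by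
    rintro (l | m) (l' | m')
    · exact swapSum_firstPlaces_commute _ _
    · exact swapSum_firstPlaces_commute_indicatorMap (l.2.trans m'.2)
    · exact (swapSum_firstPlaces_commute_indicatorMap (l'.2.trans m.2)).symm
    · exact indicatorMap_commute _ _
  obtain ⟨b, hb⟩ := exists_orthonormalBasis_joint_eigenvectors (κ := KSet n k)
    finrank_euclideanSpace hT fun t t' _ => hC t t'
  refine ⟨b, (isGTBasis_iff hi _).2 fun x => ?_⟩
  obtain ⟨χ, hχ⟩ := hb x
  obtain ⟨y, hy⟩ : ∃ y, b x y ≠ 0 := by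
    by_contra! h
    exact b.orthonormal.ne_zero x (PiLp.ext h)
  refine ⟨fun l => if hl : l ≤ i then (χ (Sum.inl ⟨l, hl⟩) : ℂ) else 0, y, ?_⟩
  rw [ofRealBasis_apply, mem_jointEigenspace, mem_suffixSpace]
  refine ⟨fun l hl => ?_, fun z hz m hm => ?_⟩
  · rw [swapSum_ofRealFun, dif_pos hl]
    exact (congrArg (ofRealFun ℂ) (hχ (Sum.inl ⟨l, hl⟩))).trans (ofRealFun_smul _ _)
  · rw [ofRealFun_apply] at hz
    exact mem_iff_mem_of_indicatorMap_eq_smul (hχ (Sum.inr ⟨m, hm⟩)) (fun h => hz (by simp [h])) hy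

theorem isGTBasis_one_deltaBasis (hn : 1 ≤ n) : IsGTBasis n k 1 (deltaBasis n k) := by
  rw [isGTBasis_iff hn]
  refine fun x => ⟨fun l => l, x, mem_jointEigenspace.2 ⟨fun l hl => ?_,
    Submodule.subset_span ⟨x, fun m _ => Iff.rfl, rfl⟩⟩⟩
  interval_cases l
  · rw [firstPlaces_zero, swapSum_empty, Nat.cast_zero, zero_smul, LinearMap.zero_apply]
  · rw [firstPlaces_one hn, swapSum_singleton, Nat.cast_one, one_smul, Module.End.one_apply]

theorem exists_isBasisChain_real (hn : 1 ≤ n) :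
    ∃ b : ℕ → OrthonormalBasis (KSet n k) ℝ (EuclideanSpace ℝ (KSet n k)),
      IsBasisChain n k fun i => ofRealBasis ℂ (b i) := by
  have h (i : ℕ) : ∃ b : OrthonormalBasis (KSet n k) ℝ (EuclideanSpace ℝ (KSet n k)),
      i ≤ n → IsGTBasis n k i (ofRealBasis ℂ b) := by
    by_cases hi : i ≤ n
    · exact (exists_real_isGTBasis hi).imp fun _ hb _ => hb
    · exact ⟨EuclideanSpace.basisFun _ ℝ, fun h => absurd h hi⟩
  choose b hb using h
  refine ⟨fun i => if i ≤ 1 then EuclideanSpace.basisFun _ ℝ else b i,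
    ofRealBasis_basisFun, rfl, fun i hi hin => ?_⟩
  dsimp only
  split_ifs with h1
  · obtain rfl : i = 1 := le_antisymm h1 hi
    rw [ofRealBasis_basisFun]
    exact isGTBasis_one_deltaBasis hn
  · exact hb i hin

end RealBases

section Factors

variable {n k : ℕ}

theorem changeMatrix_apply (b b' : OrthonormalBasis (KSet n k) ℂ (FunSpace n k))
    (x y : KSet n k) : changeMatrix b b' x y = inner ℂ (b' x) (b y) := by
  rw [changeMatrix, Module.Basis.toMatrix_apply, OrthonormalBasis.coe_toBasis_repr_apply,
    OrthonormalBasis.repr_apply_apply]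

theorem exists_orthogonal_changeMatrix_ofRealBasis
    (b b' : OrthonormalBasis (KSet n k) ℝ (EuclideanSpace ℝ (KSet n k))) :
    ∃ Q ∈ Matrix.orthogonalGroup (KSet n k) ℝ,
      changeMatrix (ofRealBasis ℂ b) (ofRealBasis ℂ b') = Q.map Complex.ofReal := by
  refine ⟨b'.toBasis.toMatrix b, b'.toMatrix_orthonormalBasis_mem_orthogonal b, ?_⟩
  ext x y
  rw [changeMatrix_apply, ofRealBasis_apply, ofRealBasis_apply, inner_ofRealFun,
    Matrix.map_apply, Module.Basis.toMatrix_apply, OrthonormalBasis.coe_toBasis_repr_apply,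
    OrthonormalBasis.repr_apply_apply]
  rfl

theorem changeMatrix_mul (b b' b'' : OrthonormalBasis (KSet n k) ℂ (FunSpace n k)) :
    changeMatrix b' b'' * changeMatrix b b' = changeMatrix b b'' := by
  simpa [changeMatrix] using
    Module.Basis.toMatrix_mul_toMatrix b''.toBasis b'.toBasis (b : KSet n k → FunSpace n k)

theorem changeMatrix_self (b : OrthonormalBasis (KSet n k) ℂ (FunSpace n k)) :
    changeMatrix b b = 1 := by
  simpa [changeMatrix] using Module.Basis.toMatrix_self b.toBasis

theorem changeMatrix_mulVec_repr (b b' : OrthonormalBasis (KSet n k) ℂ (FunSpace n k))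
    (f : FunSpace n k) : (changeMatrix b b').mulVec (b.repr f) = b'.repr f := by
  ext x
  simpa [changeMatrix, Matrix.mulVec, dotProduct] using
    congrFun (Module.Basis.toMatrix_mulVec_repr b.toBasis b'.toBasis f) x

theorem changeMatrix_eq_prod (B : ℕ → OrthonormalBasis (KSet n k) ℂ (FunSpace n k)) (m : ℕ) :
    changeMatrix (B 1) (B (m + 1)) =
      ((List.range m).map fun i => changeMatrix (B (i + 1)) (B (i + 2))).reverse.prod := by
  induction m with
  | zero => simpa using changeMatrix_self (B 1)
  | succ m ih =>
    rw [List.range_succ, List.map_append, List.reverse_append, List.prod_append, ← ih]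
    simp [changeMatrix_mul]

theorem mem_jointEigenspace_of_inner_ne_zero {i : ℕ} {c d : ℕ → ℂ} {v w : Finset (Fin n)}
    {f g : FunSpace n k} (hf : f ∈ jointEigenspace n k (i + 1) (i + 1) d v)
    (hg : g ∈ jointEigenspace n k i i c w) (hfg : inner ℂ f g ≠ 0) :
    f ∈ jointEigenspace n k (i + 1) i c w :=
  jointEigenspace_le_jointEigenspace le_rfl i.le_succ
    (fun _ hl => eigenvalue_eq_of_inner_ne_zero hf hg hfg (Nat.le_succ_of_le hl) hl)
    (fun _ hm => letter_iff_of_inner_ne_zero hf.2 hg.2 hfg hm (Nat.le_of_succ_le hm)) hf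

theorem ncard_changeMatrix_ne_zero_le_two {i : ℕ} (hi : i < n)
    {b b' : OrthonormalBasis (KSet n k) ℂ (FunSpace n k)} (hb : IsGTBasis n k i b)
    (hb' : IsGTBasis n k (i + 1) b') (y : KSet n k) :
    {x | changeMatrix b b' x y ≠ 0}.ncard ≤ 2 := by
  obtain ⟨c, w, hy⟩ := (isGTBasis_iff hi.le b).1 hb y
  have hmem (x : {x | changeMatrix b b' x y ≠ 0}) : b' x ∈ jointEigenspace n k (i + 1) i c w := by
    obtain ⟨d, v, hxd⟩ := (isGTBasis_iff hi b').1 hb' x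
    exact mem_jointEigenspace_of_inner_ne_zero hxd hy (changeMatrix_apply b b' x y ▸ x.2)
  have hindep : LinearIndependent ℂ
      fun x : {x | changeMatrix b b' x y ≠ 0} =>
        (⟨b' x, hmem x⟩ : jointEigenspace n k (i + 1) i c w) :=
    .of_comp (Submodule.subtype _)
      (b'.orthonormal.linearIndependent.comp _ Subtype.val_injective)
  have := Fintype.ofFinite {x | changeMatrix b b' x y ≠ 0}
  rw [← Nat.card_coe_set_eq, Nat.card_eq_fintype_card]
  exact hindep.fintype_card_le_finrank.trans (finrank_jointEigenspace_succ_le_two hi c w)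

end Factors

section Computation

theorem card_ne_zero_le_of_ncard_column_le {R κ τ : Type*} [Zero R] [DecidableEq R] [Fintype κ]
    [Fintype τ] {M : Matrix κ τ R} {d : ℕ} (hM : ∀ y, {x | M x y ≠ 0}.ncard ≤ d) :
    #{q : κ × τ | M q.1 q.2 ≠ 0} ≤ d * Fintype.card τ := by
  have hcolumn (y : τ) : ∑ x, (if M x y ≠ 0 then 1 else 0) ≤ d := by
    rw [← Finset.card_filter, ← Set.ncard_coe_finset, Finset.coe_filter_univ]
    exact hM y
  rw [Finset.card_filter, Fintype.sum_prod_type_right, mul_comm]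
  exact Finset.sum_le_card_nsmul _ _ d fun y _ => hcolumn y

namespace Computation

variable {ι : Type} {A : Set ℂ} {m : ℕ} {S : Set ((ι → ℂ) → ℂ)}

theorem zero_mem (h : Computation A m S) : (fun _ => 0) ∈ S := by
  induction h with
  | start => exact Set.mem_insert _ _
  | mulAdd _ _ _ _ ih => exact Set.mem_insert_of_mem _ ih

variable {κ τ : Type*} {M : Matrix κ τ ℂ} {U : τ → (ι → ℂ) → ℂ}

theorem exists_sum_mul_mem [DecidableEq κ] (h : Computation A m S) (hM : ∀ x y, M x y ∈ A)
    (hU : ∀ y, U y ∈ S) (P : Finset (κ × τ)) :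
    ∃ S', Computation A (m + #P) S' ∧ S ⊆ S' ∧
      ∀ x, (fun a => ∑ q ∈ P with q.1 = x, M q.1 q.2 * U q.2 a) ∈ S' := by
  classical
  induction P using Finset.induction_on with
  | empty => exact ⟨S, h, subset_rfl, fun x => by simpa using h.zero_mem⟩
  | insert q P hq ih =>
    obtain ⟨S', hS', hSS', hP⟩ := ih
    refine ⟨insert (fun a => M q.1 q.2 * U q.2 a +
      ∑ r ∈ P with r.1 = q.1, M r.1 r.2 * U r.2 a) S', ?_, ?_, fun x => ?_⟩
    · rw [Finset.card_insert_of_notMem hq, ← add_assoc]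
      exact hS'.mulAdd (hM q.1 q.2) (hSS' (hU q.2)) (hP q.1)
    · exact hSS'.trans (Set.subset_insert _ _)
    · rw [Finset.filter_insert]
      split_ifs with hx
      · left
        subst hx
        ext a
        rw [Finset.sum_insert fun hmem => hq (Finset.mem_filter.1 hmem).1]
      · exact Set.mem_insert_of_mem _ (hP x)

theorem exists_mulVec_mem [Finite κ] [Fintype τ] (h : Computation A m S)
    (hM : ∀ x y, M x y ∈ A) {d : ℕ} (hd : ∀ y, {x | M x y ≠ 0}.ncard ≤ d) (hU : ∀ y, U y ∈ S) :
    ∃ m' ≤ m + d * Fintype.card τ, ∃ S', Computation A m' S' ∧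
      ∀ x, (fun a => M.mulVec (fun y => U y a) x) ∈ S' := by
  classical
  have := Fintype.ofFinite κ
  obtain ⟨S', hS', -, hP⟩ := h.exists_sum_mul_mem hM hU {q | M q.1 q.2 ≠ 0}
  refine ⟨_, Nat.add_le_add_left (card_ne_zero_le_of_ncard_column_le hd) m, S', hS', fun x => ?_⟩
  convert hP x using 2 with a
  rw [Finset.filter_filter, Finset.sum_filter, Fintype.sum_prod_type,
    Fintype.sum_eq_single x fun x' hx' => by simp [hx']]
  refine Finset.sum_congr rfl fun y _ => ?_
  by_cases hxy : M x y = 0 <;> simp [hxy]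

end Computation

theorem card_kSet (n k : ℕ) : Fintype.card (KSet n k) = n.choose k := by
  rw [← Nat.card_eq_fintype_card, Set.powersetCard.card, Nat.card_fin]

theorem exists_computation_repr {n k : ℕ}
    {B : ℕ → OrthonormalBasis (KSet n k) ℂ (FunSpace n k)}
    (hB : IsBasisChain n k B) {j : ℕ} (hj : j + 1 ≤ n) :
    ∃ m ≤ 2 * j * n.choose k, ∃ S : Set ((KSet n k → ℂ) → ℂ),
      Computation {c | ∃ i, 1 ≤ i ∧ i < n ∧ ∃ x y, c = changeMatrix (B i) (B (i + 1)) x y} m S ∧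
      ∀ x, ∃ g ∈ S, ∀ f : FunSpace n k,
        g (fun y => (B 0).repr f y) = (B (j + 1)).repr f x := by
  induction j with
  | zero =>
    refine ⟨0, Nat.zero_le _, _, .start, fun x => ⟨fun a => a x, ?_, fun f => ?_⟩⟩
    · exact Set.mem_insert_of_mem _ ⟨x, rfl⟩
    · rw [zero_add, hB.one]
  | succ j ih =>
    obtain ⟨m, hm, S, hS, hg⟩ := ih (by lia)
    choose U hU hUf using hg
    have hsparse := ncard_changeMatrix_ne_zero_le_two (by lia)
      (hB.gt (j + 1) (by lia) (by lia)) (hB.gt (j + 2) (by lia) hj)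
    obtain ⟨m', hm', S', hS', hS''⟩ := hS.exists_mulVec_mem
      (fun x y => ⟨j + 1, by lia, by lia, x, y, rfl⟩) hsparse hU
    refine ⟨m', ?_, S', hS', fun x => ⟨_, hS'' x, fun f => ?_⟩⟩
    · calc m' ≤ m + 2 * Fintype.card (KSet n k) := hm'
        _ ≤ 2 * j * n.choose k + 2 * n.choose k := by rw [card_kSet]; gcongr
        _ = 2 * (j + 1) * n.choose k := by ring
    · simp only [hUf]
      exact congrFun (changeMatrix_mulVec_repr _ _ f) x

end Computation

end JohnsonFFT

theorem mainTheorem1 (n k : ℕ) (hn : 1 ≤ n) (hk : k ≤ n) :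
    -- the spaces that define the bases are lines or zero: the bases are unique up to scalars
    (∀ i ≤ n, ∀ (C : ℕ → Submodule ℂ (JohnsonFFT.FunSpace n k)) (w : Finset (Fin n)),
      (∀ j ∈ Finset.Icc 1 i, C j ∈ JohnsonFFT.isotypicSpaces n k j) →
        Module.finrank ℂ (JohnsonFFT.gtSpace n k i C w) ≤ 1) ∧
    -- the bases exist, and with a suitable choice of scalars the factors are real orthogonal
    (∃ B : ℕ → OrthonormalBasis (JohnsonFFT.KSet n k) ℂ (JohnsonFFT.FunSpace n k),
      JohnsonFFT.IsBasisChain n k B ∧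
      ∀ i, 1 ≤ i → i < n → ∃ Q ∈ Matrix.orthogonalGroup (JohnsonFFT.KSet n k) ℝ,
        JohnsonFFT.changeMatrix (B i) (B (i + 1)) = Q.map Complex.ofReal) ∧
    -- for every choice of the bases:
    (∀ B : ℕ → OrthonormalBasis (JohnsonFFT.KSet n k) ℂ (JohnsonFFT.FunSpace n k),
      JohnsonFFT.IsBasisChain n k B →
      -- the factorization `[B 0]_{B n} = [B (n-1)]_{B n} ⋯ [B 1]_{B 2}`
      JohnsonFFT.changeMatrix (B 0) (B n) =
        ((List.range (n - 1)).map fun i =>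
          JohnsonFFT.changeMatrix (B (i + 1)) (B (i + 2))).reverse.prod ∧
      -- the factors are unitary, with at most two nonzero entries in each column
      (∀ i, 1 ≤ i → i < n →
        JohnsonFFT.changeMatrix (B i) (B (i + 1)) ∈
            Matrix.unitaryGroup (JohnsonFFT.KSet n k) ℂ ∧
        ∀ y, {x | JohnsonFFT.changeMatrix (B i) (B (i + 1)) x y ≠ 0}.ncard ≤ 2) ∧
      -- the Fourier transform takes at most `2 (n - 1) (n choose k)` operations, with the entries
      -- of the factors as the only constants
      ∃ m ≤ 2 * (n - 1) * n.choose k, ∃ S : Set ((JohnsonFFT.KSet n k → ℂ) → ℂ),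
        JohnsonFFT.Computation
          {c | ∃ i, 1 ≤ i ∧ i < n ∧ ∃ x y, c = JohnsonFFT.changeMatrix (B i) (B (i + 1)) x y} m S ∧
        ∀ x, ∃ g ∈ S, ∀ f : JohnsonFFT.FunSpace n k,
          g (fun y => (B 0).repr f y) = (B n).repr f x) := by
  refine ⟨fun i hi C w hC => JohnsonFFT.finrank_gtSpace_le_one hi hC w, ?_, fun B hB => ?_⟩
  · obtain ⟨b, hb⟩ := JohnsonFFT.exists_isBasisChain_real (k := k) hn
    exact ⟨_, hb, fun i _ _ =>
      JohnsonFFT.exists_orthogonal_changeMatrix_ofRealBasis (b i) (b (i + 1))⟩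
  · obtain ⟨m, rfl⟩ : ∃ m, n = m + 1 := ⟨n - 1, by lia⟩
    refine ⟨?_, fun i hi hin => ⟨?_, fun y => ?_⟩, ?_⟩
    · rw [← hB.one]
      exact JohnsonFFT.changeMatrix_eq_prod B m
    · exact (B (i + 1)).toMatrix_orthonormalBasis_mem_unitary (B i)
    · exact JohnsonFFT.ncard_changeMatrix_ne_zero_le_two hin (hB.gt i hi hin.le)
        (hB.gt (i + 1) (by lia) hin) y
    · exact JohnsonFFT.exists_computation_repr hB le_rfl
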